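/- Let $\mathsf R^0\colon[0,\infty)^2\to\mathbb R$ be given by $$\mathsf R^0(t,s)=\begin{cases}0,& t\wedge s=0,\\ \tfrac12,& t,s>0,\ t\ne s,\\ \tfrac12\left(1+e^{2t}\right),& t=s>0.\end{cases}$$ Then $\mathsf R^0$ is a covariance function, i.e. it is symmetric and positive definite in the sense that $\sum_{i,j=1}^k\mathsf R^0(t_i,t_j)z_iz_j\ge0$ for all $k\ge 0$, $t_1,\dots,t_k\ge0$ and $z_1,\dots,z_k\in\mathbb R$, and there exists a Gaussian process $X^0=\{X^0_t,\ t\ge0\}$ with zero mean and covariance function $\mathsf R^0$. For each $0<H<\frac12$ let $B^H=\{B^H_t,\ t\ge0\}$ be a fractional Brownian motion with Hurst index $H$, i.e. a Gaussian process with zero mean, covariance function $\mathsf E B^H_tB^H_s=\frac12\left(t^{2H}+s^{2H}-|t-s|^{2H}\right)$ and almost surely continuous trajectories (the probability space may depend on $H$), and let $$X^H_t=e^tB^H_t-\int_0^te^sB^H_s\,ds,\qquad t\ge0.$$ Then, as $H\downarrow0$, the finite-dimensional distributions of $X^H$ converge weakly to those of $X^0$, where $X^0$ is any Gaussian process with zero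 mean and covariance function $\mathsf R^0$: for all $k$ and $t_1,\dots,t_k\ge0$, the law of $(X^H_{t_1},\dots,X^H_{t_k})$ converges weakly to the law of $(X^0_{t_1},\dots,X^0_{t_k})$. -/

import Mathlib

open MeasureTheory ProbabilityTheory Filter Topology Set
open scoped NNReal

universe u v

noncomputable section

/-- `X` is a Gaussian process indexed by `[0, ∞)` with zero mean and covariance function `K`. -/
structure IsCenteredGaussian {Ω : Type*} [MeasurableSpace Ω]
    (X : ℝ≥0 → Ω → ℝ) (P : Measure Ω) (K : ℝ≥0 → ℝ≥0 → ℝ) : Prop where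
  isGaussianProcess : IsGaussianProcess X P
  mean_zero : ∀ t, ∫ ω, X t ω ∂P = 0
  covariance_eq : ∀ t s, cov[X t, X s; P] = K t s

/-- A covariance function on `[0, ∞)`: symmetric and positive definite, in the usual sense that
all its quadratic forms are nonnegative. -/
structure IsCovarianceFunction (K : ℝ≥0 → ℝ≥0 → ℝ) : Prop where
  symm : ∀ t s, K t s = K s t
  nonneg : ∀ (k : ℕ) (t : Fin k → ℝ≥0) (z : Fin k → ℝ),
    0 ≤ ∑ i, ∑ j, K (t i) (t j) * z i * z j

/-- The covariance function of fractional Brownian motion with Hurst index `H`. -/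
def fbmCov (H : ℝ) (t s : ℝ≥0) : ℝ :=
  ((t : ℝ) ^ (2 * H) + (s : ℝ) ^ (2 * H) - |(t : ℝ) - s| ^ (2 * H)) / 2

/-- `B` is a fractional Brownian motion with Hurst index `H`: a centered Gaussian process with the
fractional covariance function and almost surely continuous trajectories. -/
structure IsFBM {Ω : Type*} [MeasurableSpace Ω]
    (H : ℝ) (B : ℝ≥0 → Ω → ℝ) (P : Measure Ω) : Prop where
  isCenteredGaussian : IsCenteredGaussian B P (fbmCov H)
  ae_continuous : ∀ᵐ ω ∂P, Continuous fun t : ℝ≥0 ↦ B t ω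

/-- The process `X_t = e^t B_t - ∫_0^t e^s B_s ds`, the integral being taken pathwise. -/
def expWiener {Ω : Type*} (B : ℝ≥0 → Ω → ℝ) (t : ℝ≥0) (ω : Ω) : ℝ :=
  Real.exp t * B t ω - ∫ s in (0 : ℝ)..t, Real.exp s * B s.toNNReal ω

/-- The limiting covariance function. -/
def R0 (t s : ℝ≥0) : ℝ :=
  if min t s = 0 then 0
  else if t = s then (1 + Real.exp (2 * t)) / 2
  else 1 / 2

end

/-! Each `expWiener B t` is the linear functional `expFunctional t` of a Gaussian path, so its joint
characteristic functions are Gaussian, with covariance obtained by applying the functional in both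
variables of `fbmCov H`. This is proved without Fubini, by Riemann sums
(`integral_cexp_sum_expWiener`). As `H ↓ 0`, `fbmCov H` converges pointwise, boundedly on compacts,
to `fbmCovZero`, which on positive times is 1/2 off the diagonal and 1 on it. The constant 1/2
contributes (e^t - (e^t - 1))(e^s - (e^s - 1))/2 = 1/2; the diagonal is invisible to the integrals
and adds e^(2t)/2 only when t = s. This gives `R0`, and Lévy's theorem concludes. -/

/-- A Riemann sum on the unit interval as the integral of a step function. -/
theorem integral_floor_div_eq_sum (g : ℝ → ℝ) {n : ℕ} (hn : n ≠ 0) :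
    ∫ u in (0 : ℝ)..1, g ((⌊u * n⌋₊ : ℝ) / n) = (n : ℝ)⁻¹ * ∑ k ∈ Finset.range n, g ((k : ℝ) / n) := by
  have hn' : (0 : ℝ) < n := by positivity
  have hcongr (k : ℕ) : EqOn (fun u : ℝ ↦ g ((⌊u * n⌋₊ : ℝ) / n)) (fun _ ↦ g ((k : ℝ) / n))
      (Ioo ((k : ℝ) / n) (((k + 1 : ℕ) : ℝ) / n)) := by
    intro u hu
    have h1 := (div_lt_iff₀ hn').1 hu.1
    have h2 := (lt_div_iff₀ hn').1 hu.2
    have : ⌊u * n⌋₊ = k := by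
      rw [Nat.floor_eq_iff (le_trans (by positivity) h1.le)]
      push_cast at h2
      exact ⟨h1.le, h2⟩
    simp only [this]
  have hle (k : ℕ) : (k : ℝ) / n ≤ ((k + 1 : ℕ) : ℝ) / n := by gcongr; simp
  have hint (k : ℕ) : ∫ u in ((k : ℝ) / n)..(((k + 1 : ℕ) : ℝ) / n), g ((⌊u * n⌋₊ : ℝ) / n)
      = (n : ℝ)⁻¹ * g ((k : ℝ) / n) := by
    rw [intervalIntegral.integral_congr_Ioo_of_le (hle k) (hcongr k), intervalIntegral.integral_const]
    push_cast
    rw [smul_eq_mul]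
    congr 1
    field_simp
    ring
  have hii (k : ℕ) : IntervalIntegrable (fun u : ℝ ↦ g ((⌊u * n⌋₊ : ℝ) / n)) volume
      ((k : ℝ) / n) (((k + 1 : ℕ) : ℝ) / n) := by
    rw [intervalIntegrable_iff_integrableOn_Ioo_of_le (hle k)]
    exact (integrableOn_congr_fun (hcongr k) measurableSet_Ioo).2 (by simp)
  have := intervalIntegral.sum_integral_adjacent_intervals
    (a := fun k : ℕ ↦ (k : ℝ) / n) (n := n) (fun k _ ↦ hii k)
  simp only [hint, Nat.cast_zero, zero_div, div_self hn'.ne'] at this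
  rw [← this, Finset.mul_sum]

/-- Riemann sums of continuously converging, uniformly bounded functions. -/
theorem tendsto_riemannSum {g : ℕ → ℝ → ℝ} {g₀ : ℝ → ℝ} {M : ℝ} (hm : ∀ n, Measurable (g n))
    (hM : ∀ n, ∀ x ∈ Icc (0 : ℝ) 1, |g n x| ≤ M)
    (hg : ∀ (x : ℕ → ℝ) (y : ℝ), Tendsto x atTop (𝓝 y) →
      Tendsto (fun n ↦ g n (x n)) atTop (𝓝 (g₀ y))) :
    Tendsto (fun n : ℕ ↦ (n : ℝ)⁻¹ * ∑ k ∈ Finset.range n, g n ((k : ℝ) / n)) atTop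
      (𝓝 (∫ u in (0 : ℝ)..1, g₀ u)) := by
  have key : Tendsto (fun n : ℕ ↦ ∫ u in (0 : ℝ)..1, g n ((⌊u * n⌋₊ : ℝ) / n)) atTop
      (𝓝 (∫ u in (0 : ℝ)..1, g₀ u)) := by
    refine intervalIntegral.tendsto_integral_filter_of_dominated_convergence (fun _ ↦ M)
      (Eventually.of_forall fun n ↦ ?_) ?_ (by simp) (ae_of_all _ fun u hu ↦ ?_)
    · have : Measurable fun u : ℝ ↦ g n ((⌊u * n⌋₊ : ℝ) / n) := by
        have := hm n
        fun_prop
      exact this.aestronglyMeasurable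
    · filter_upwards [eventually_ne_atTop 0] with n hn
      refine ae_of_all _ fun u hu ↦ ?_
      rw [uIoc_of_le zero_le_one] at hu
      have hn' : (0 : ℝ) < n := by positivity
      refine hM n _ ⟨by positivity, ?_⟩
      rw [div_le_one hn']
      have : 0 < u := hu.1
      refine (Nat.floor_le (by positivity)).trans ?_
      nlinarith [hu.2]
    · rw [uIoc_of_le zero_le_one] at hu
      exact hg _ _ ((tendsto_nat_floor_mul_div_atTop hu.1.le).comp tendsto_natCast_atTop_atTop)
  refine key.congr' ?_
  filter_upwards [eventually_ne_atTop 0] with n hn using integral_floor_div_eq_sum _ hn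

/-! ### The functional and its discretization -/

/-- The linear functional `f ↦ e^t f(t) - ∫_0^t e^s f(s) ds` on functions on `[0, ∞)`. -/
noncomputable def expFunctional (t : ℝ≥0) (f : ℝ≥0 → ℝ) : ℝ :=
  Real.exp t * f t - ∫ s in (0 : ℝ)..t, Real.exp s * f s.toNNReal

/-- The nodes of the discretized functional `expFunctional t`. -/
noncomputable def expNode (n : ℕ) (t : ℝ≥0) : Option (Fin n) → ℝ≥0
  | none => t
  | some k => (t * ((k : ℕ) / n : ℝ)).toNNReal

/-- The weights of the discretized functional `expFunctional t`. -/
noncomputable def expWeight (n : ℕ) (t : ℝ≥0) : Option (Fin n) → ℝ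
  | none => Real.exp t
  | some k => -(t * ((n : ℝ)⁻¹ * Real.exp (t * ((k : ℕ) / n : ℝ))))

/-- The discretization of `expFunctional t` by Riemann sums. -/
noncomputable def expSum (n : ℕ) (t : ℝ≥0) (f : ℝ≥0 → ℝ) : ℝ :=
  ∑ j, expWeight n t j * f (expNode n t j)

theorem expSum_eq (n : ℕ) (t : ℝ≥0) (f : ℝ≥0 → ℝ) :
    expSum n t f = Real.exp t * f t - t * ((n : ℝ)⁻¹ * ∑ k ∈ Finset.range n,
      (Real.exp (t * ((k : ℝ) / n)) * f (t * ((k : ℝ) / n)).toNNReal)) := by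
  simp only [expSum, Fintype.sum_option, expWeight, expNode, Finset.sum_range, sub_eq_add_neg,
    Finset.mul_sum, ← Finset.sum_neg_distrib]
  congr 1
  exact Finset.sum_congr rfl fun k _ ↦ by ring

theorem expFunctional_eq (t : ℝ≥0) (f : ℝ≥0 → ℝ) :
    expFunctional t f = Real.exp t * f t -
      t * ∫ u in (0 : ℝ)..1, Real.exp (t * u) * f (t * u).toNNReal := by
  have := intervalIntegral.smul_integral_comp_mul_left (a := 0) (b := 1)
    (fun s ↦ Real.exp s * f s.toNNReal) (t : ℝ)
  rw [expFunctional, ← smul_eq_mul (t : ℝ), this]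
  simp

theorem expNode_le (n : ℕ) (t : ℝ≥0) (j : Option (Fin n)) : expNode n t j ≤ t := by
  cases j with
  | none => exact le_rfl
  | some k =>
    have hk : ((k : ℕ) : ℝ) ≤ n := by exact_mod_cast k.2.le
    refine Real.toNNReal_le_iff_le_coe.2 (mul_le_of_le_one_right t.2 ?_)
    exact div_le_one_of_le₀ hk (by positivity)

theorem abs_expSum_le (n : ℕ) (t : ℝ≥0) {f : ℝ≥0 → ℝ} {M : ℝ} (hf : ∀ x ≤ t, |f x| ≤ M) :
    |expSum n t f| ≤ (1 + t) * Real.exp t * M := by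
  have hM : 0 ≤ M := (abs_nonneg _).trans (hf t le_rfl)
  rw [expSum, Fintype.sum_option]
  have hsome (k : Fin n) : |expWeight n t (some k) * f (expNode n t (some k))| ≤
      (n : ℝ)⁻¹ * (t * Real.exp t * M) := by
    rw [abs_mul]
    have hk : ((k : ℕ) : ℝ) ≤ n := by exact_mod_cast k.2.le
    have h1 : (t : ℝ) * ((k : ℕ) / n : ℝ) ≤ t :=
      mul_le_of_le_one_right t.2 (div_le_one_of_le₀ hk (by positivity))
    calc |expWeight n t (some k)| * |f (expNode n t (some k))|
        ≤ (t * ((n : ℝ)⁻¹ * Real.exp t)) * M := by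
          gcongr
          · simp only [expWeight, abs_neg]
            rw [abs_of_nonneg (by positivity)]
            gcongr
          · exact hf _ (expNode_le _ _ _)
      _ = _ := by ring
  have hsum : |∑ k : Fin n, expWeight n t (some k) * f (expNode n t (some k))| ≤
      t * Real.exp t * M := by
    refine (Finset.abs_sum_le_sum_abs _ _).trans ((Finset.sum_le_sum fun k _ ↦ hsome k).trans ?_)
    rw [Finset.sum_const, Finset.card_univ, Fintype.card_fin, nsmul_eq_mul, ← mul_assoc]
    exact mul_le_of_le_one_left (by positivity) (mul_inv_le_one)
  have hnone : |expWeight n t none * f (expNode n t none)| ≤ Real.exp t * M := by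
    rw [abs_mul]
    simp only [expWeight, Real.abs_exp]
    gcongr
    exact hf _ (expNode_le _ _ _)
  refine (abs_add_le _ _).trans ?_
  linarith

/-- Convergence along moving points lets the integrand vary with `n` together with the nodes, as the
inner sum of a double Riemann sum does. -/
theorem tendsto_expSum {t : ℝ≥0} {f : ℕ → ℝ≥0 → ℝ} {f₀ : ℝ≥0 → ℝ} {M : ℝ}
    (hm : ∀ n, Measurable (f n)) (hM : ∀ n, ∀ x ≤ t, |f n x| ≤ M)
    (hf : ∀ (x : ℕ → ℝ≥0) (y : ℝ≥0), Tendsto x atTop (𝓝 y) →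
      Tendsto (fun n ↦ f n (x n)) atTop (𝓝 (f₀ y))) :
    Tendsto (fun n ↦ expSum n t (f n)) atTop (𝓝 (expFunctional t f₀)) := by
  simp only [expSum_eq, expFunctional_eq]
  refine ((hf _ _ tendsto_const_nhds).const_mul _).sub (Tendsto.const_mul _ ?_)
  refine tendsto_riemannSum (M := Real.exp t * M)
    (g := fun n u ↦ Real.exp (t * u) * f n (t * u).toNNReal) (fun n ↦ ?_) (fun n u hu ↦ ?_)
    (fun x y hxy ↦ ?_)
  · have := hm n
    fun_prop
  · have h1 : (t : ℝ) * u ≤ t := mul_le_of_le_one_right t.2 hu.2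
    rw [abs_mul, Real.abs_exp]
    gcongr
    exact hM n _ (Real.toNNReal_le_iff_le_coe.2 h1)
  · have h1 : Tendsto (fun n ↦ (t : ℝ) * x n) atTop (𝓝 (t * y)) := hxy.const_mul _
    exact ((Real.continuous_exp.tendsto _).comp h1).mul
      (hf _ _ ((continuous_real_toNNReal.tendsto _).comp h1))

theorem tendsto_expSum_of_continuous (t : ℝ≥0) {f : ℝ≥0 → ℝ} (hf : Continuous f) :
    Tendsto (fun n ↦ expSum n t f) atTop (𝓝 (expFunctional t f)) := by
  obtain ⟨M, hM⟩ := (isCompact_Icc (a := 0) (b := t)).exists_bound_of_continuousOn hf.continuousOn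
  exact tendsto_expSum (fun _ ↦ hf.measurable) (fun _ x hx ↦ hM x ⟨zero_le, hx⟩)
    fun x y hxy ↦ (hf.tendsto y).comp hxy

/-- Double Riemann sums of a continuous kernel. -/
theorem tendsto_expSum_expSum (t s : ℝ≥0) {K : ℝ≥0 → ℝ≥0 → ℝ}
    (hK : Continuous fun p : ℝ≥0 × ℝ≥0 ↦ K p.1 p.2) :
    Tendsto (fun n ↦ expSum n t fun a ↦ expSum n s (K a)) atTop
      (𝓝 (expFunctional t fun a ↦ expFunctional s (K a))) := by
  obtain ⟨M, hM⟩ := ((isCompact_Icc (a := 0) (b := t)).prod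
    (isCompact_Icc (a := 0) (b := s))).exists_bound_of_continuousOn hK.continuousOn
  have hK1 (a : ℝ≥0) : Continuous (K a) := hK.comp (by fun_prop : Continuous fun b ↦ (a, b))
  have hK2 (b : ℝ≥0) : Continuous fun a ↦ K a b :=
    hK.comp (by fun_prop : Continuous fun a ↦ (a, b))
  refine tendsto_expSum (M := (1 + s) * Real.exp s * M) (fun n ↦ ?_) (fun n a ha ↦ ?_)
    fun x y hxy ↦ ?_
  · have : Continuous fun a ↦ expSum n s (K a) := by
      unfold expSum
      exact continuous_finsetSum _ fun j _ ↦ (hK2 _).const_mul _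
    exact this.measurable
  · exact abs_expSum_le n s fun b hb ↦ hM (a, b) ⟨⟨zero_le, ha⟩, ⟨zero_le, hb⟩⟩
  -- The points `x n` need not stay below `t`, so the kernel is bounded again on a box containing
  -- them all.
  · obtain ⟨R, hR⟩ := hxy.bddAbove_range
    obtain ⟨M', hM'⟩ := ((isCompact_Icc (a := 0) (b := R)).prod
      (isCompact_Icc (a := 0) (b := s))).exists_bound_of_continuousOn hK.continuousOn
    refine tendsto_expSum (M := M') (fun n ↦ (hK1 _).measurable)
      (fun n b hb ↦ hM' (x n, b) ⟨⟨zero_le, hR ⟨n, rfl⟩⟩, ⟨zero_le, hb⟩⟩) fun b c hbc ↦ ?_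
    exact (hK.tendsto (y, c)).comp (hxy.prodMk_nhds hbc)

/-! ### Linear combinations of Gaussian variables -/

theorem covariance_fun_sum_mul {Ω ι κ : Type*} [MeasurableSpace Ω] {P : Measure Ω}
    [IsProbabilityMeasure P] [Fintype ι] [Fintype κ] {X : ι → Ω → ℝ} {Y : κ → Ω → ℝ}
    (hX : ∀ i, MemLp (X i) 2 P) (hY : ∀ j, MemLp (Y j) 2 P) (c : ι → ℝ) (d : κ → ℝ) :
    cov[fun ω ↦ ∑ i, c i * X i ω, fun ω ↦ ∑ j, d j * Y j ω; P] =
      ∑ i, ∑ j, cov[X i, Y j; P] * c i * d j := by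
  rw [covariance_fun_sum_fun_sum (fun i ↦ (hX i).const_mul _) (fun j ↦ (hY j).const_mul _)]
  refine Finset.sum_congr rfl fun i _ ↦ Finset.sum_congr rfl fun j _ ↦ ?_
  rw [covariance_const_mul_left, covariance_const_mul_right]
  ring

theorem ProbabilityTheory.IsGaussianProcess.hasGaussianLaw_comp {Ω T ι : Type*}
    [MeasurableSpace Ω] [Fintype ι] {P : Measure Ω} {X : T → Ω → ℝ} (hX : IsGaussianProcess X P)
    (τ : ι → T) : HasGaussianLaw (fun ω i ↦ X (τ i) ω) P := by
  have h := (hX.comp_right τ).hasGaussianLaw (Finset.univ : Finset ι)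
  let L : ({i // i ∈ (Finset.univ : Finset ι)} → ℝ) →L[ℝ] (ι → ℝ) :=
    { toFun := fun x i ↦ x ⟨i, Finset.mem_univ i⟩
      map_add' := fun _ _ ↦ rfl
      map_smul' := fun _ _ ↦ rfl }
  exact h.map L

namespace IsCenteredGaussian

variable {Ω : Type*} [MeasurableSpace Ω] {P : Measure Ω} {X : ℝ≥0 → Ω → ℝ} {K : ℝ≥0 → ℝ≥0 → ℝ}

theorem memLp_two (hX : IsCenteredGaussian X P K) (t : ℝ≥0) : MemLp (X t) 2 P :=
  (hX.isGaussianProcess.hasGaussianLaw_eval t).memLp_two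

/-- The variance of a linear combination of values of a centered Gaussian process. -/
theorem variance_sum (hX : IsCenteredGaussian X P K) {ι : Type*} [Fintype ι] (c : ι → ℝ)
    (τ : ι → ℝ≥0) :
    Var[fun ω ↦ ∑ i, c i * X (τ i) ω; P] = ∑ i, ∑ j, K (τ i) (τ j) * c i * c j := by
  have := hX.isGaussianProcess.isProbabilityMeasure
  have hm (i : ι) := hX.memLp_two (τ i)
  rw [← covariance_self, covariance_fun_sum_mul hm hm]
  · simp only [hX.covariance_eq]
  · exact (memLp_finsetSum _ fun i _ ↦ (hm i).const_mul (c i)).aestronglyMeasurable.aemeasurable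

theorem isCovarianceFunction (hX : IsCenteredGaussian X P K) : IsCovarianceFunction K where
  symm t s := by rw [← hX.covariance_eq, covariance_comm, hX.covariance_eq]
  nonneg k t z := by
    rw [← hX.variance_sum z t]
    exact variance_nonneg _ _

/-- The characteristic function of a linear combination of values of a centered Gaussian
process. -/
theorem integral_cexp_sum (hX : IsCenteredGaussian X P K) {ι : Type*} [Fintype ι] (c : ι → ℝ)
    (τ : ι → ℝ≥0) :
    ∫ ω, Complex.exp ((∑ i, c i * X (τ i) ω : ℝ) * Complex.I) ∂P =
      Complex.exp (-((∑ i, ∑ j, K (τ i) (τ j) * c i * c j : ℝ) : ℂ) / 2) := by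
  have h : HasGaussianLaw (fun ω ↦ ∑ i, c i * X (τ i) ω) P :=
    ((hX.isGaussianProcess.hasGaussianLaw_comp τ).map
      (∑ i, c i • ContinuousLinearMap.proj (R := ℝ) (φ := fun _ : ι ↦ ℝ) i)).congr
      (ae_of_all _ fun ω ↦ by simp)
  have hmean : ∫ ω, ∑ i, c i * X (τ i) ω ∂P = 0 := by
    rw [integral_finsetSum]
    · simp [integral_const_mul, hX.mean_zero]
    · exact fun i _ ↦ (hX.isGaussianProcess.hasGaussianLaw_eval _).integrable.const_mul _
  have := h.charFun_map_eq 1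
  rw [charFun_apply, integral_map h.aemeasurable (by fun_prop)] at this
  simp only [RCLike.inner_apply, conj_trivial, one_mul, mul_one, hmean,
    hX.variance_sum] at this
  rw [this]
  simp [neg_div]

end IsCenteredGaussian

/-- Take X_t = (ξ + e^t ξ_t)/√2 for t > 0 and X_0 = 0, with ξ and all ξ_t independent standard
normal: the shared ξ gives the 1/2, the private ξ_t the diagonal term. -/
theorem exists_isCenteredGaussian_R0 :
    ∃ (Ω₀ : Type) (_ : MeasurableSpace Ω₀) (P₀ : Measure Ω₀) (X₀ : ℝ≥0 → Ω₀ → ℝ),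
      IsProbabilityMeasure P₀ ∧ IsCenteredGaussian X₀ P₀ R0 := by
  obtain ⟨Ω, mΩ, P, ξ, hξm, hξ, hind, hP⟩ := exists_iid (Unit ⊕ ℝ≥0) (gaussianReal 0 1)
  have hgauss : IsGaussianProcess ξ P :=
    ⟨fun I ↦ (hind.precomp (g := ((↑) : I → Unit ⊕ ℝ≥0)) Subtype.val_injective).hasGaussianLaw
      fun i ↦ (hξ i).hasGaussianLaw⟩
  have hL2 (i : Unit ⊕ ℝ≥0) : MemLp (ξ i) 2 P := (hξ i).hasGaussianLaw.memLp_two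
  have hcov (i j : Unit ⊕ ℝ≥0) : cov[ξ i, ξ j; P] = if i = j then 1 else 0 := by
    split_ifs with h
    · subst h
      rw [covariance_self (hξm i).aemeasurable, (hξ i).variance_eq, variance_id_gaussianReal]
      simp
    · exact (hind.indepFun h).covariance_eq_zero (hL2 i) (hL2 j)
  obtain ⟨r, h2⟩ : ∃ r : ℝ, r * r = 1 / 2 := ⟨√(1 / 2), Real.mul_self_sqrt (by norm_num)⟩
  let c (t : ℝ≥0) : Fin 2 → ℝ := if t = 0 then 0 else ![r, r * Real.exp t]
  let τ (t : ℝ≥0) : Fin 2 → Unit ⊕ ℝ≥0 := ![.inl (), .inr t]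
  let X (t : ℝ≥0) (ω : Ω) : ℝ := ∑ i, c t i * ξ (τ t i) ω
  refine ⟨Ω, mΩ, P, X, hP, ?_, fun t ↦ ?_, fun t s ↦ ?_⟩
  · classical
    refine hgauss.of_isGaussianProcess fun t ↦ ⟨{.inl (), .inr t},
      c t 0 • ContinuousLinearMap.proj ⟨.inl (), by simp⟩ +
      c t 1 • ContinuousLinearMap.proj ⟨.inr t, by simp⟩, fun ω ↦ ?_⟩
    simp [X, Fin.sum_univ_two, τ]
  · simp only [X]
    rw [integral_finsetSum]
    · refine Finset.sum_eq_zero fun i _ ↦ ?_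
      rw [integral_const_mul, (hξ _).integral_eq, integral_id_gaussianReal, mul_zero]
    · exact fun i _ ↦ (hL2 _).integrable (by norm_num) |>.const_mul _
  · simp only [X]
    rw [covariance_fun_sum_mul (fun i ↦ hL2 _) (fun i ↦ hL2 _)]
    simp only [hcov, Fin.sum_univ_two, τ, c, R0]
    rcases eq_or_ne t 0 with rfl | ht
    · simp
    rcases eq_or_ne s 0 with rfl | hs
    · simp
    have hmin : min t s ≠ 0 := by
      rcases min_choice t s with h | h <;> rw [h] <;> assumption
    rcases eq_or_ne t s with rfl | hts
    · simp only [min_self, ht, if_false, if_true, Matrix.cons_val_zero, Matrix.cons_val_one]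
      have : Real.exp (2 * t) = Real.exp t * Real.exp t := by rw [two_mul, Real.exp_add]
      simp [this]
      linear_combination (1 + Real.exp t * Real.exp t) * h2
    · simp only [hmin, ht, hs, hts, if_false, Matrix.cons_val_zero, Matrix.cons_val_one]
      simp [hts]
      linear_combination h2

/-! ### Limit of the covariances -/

/-- Pointwise convergence suffices here, which matters because `fbmCovZero` is discontinuous. -/
theorem tendsto_expFunctional {t : ℝ≥0} {f : ℕ → ℝ≥0 → ℝ} {f₀ : ℝ≥0 → ℝ} {M : ℝ}
    (hm : ∀ n, Measurable (f n)) (hM : ∀ n, ∀ x ≤ t, |f n x| ≤ M)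
    (hf : ∀ x, Tendsto (fun n ↦ f n x) atTop (𝓝 (f₀ x))) :
    Tendsto (fun n ↦ expFunctional t (f n)) atTop (𝓝 (expFunctional t f₀)) := by
  refine ((hf t).const_mul _).sub ?_
  refine intervalIntegral.tendsto_integral_filter_of_dominated_convergence
    (fun _ ↦ Real.exp t * M) (Eventually.of_forall fun n ↦ ?_)
    (Eventually.of_forall fun n ↦ ae_of_all _ fun s hs ↦ ?_) (by simp)
    (ae_of_all _ fun s _ ↦ (hf _).const_mul _)
  · have : Measurable fun s : ℝ ↦ Real.exp s * f n s.toNNReal := by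
      have := hm n
      fun_prop
    exact this.aestronglyMeasurable
  · rw [uIoc_of_le t.coe_nonneg] at hs
    rw [norm_mul, Real.norm_eq_abs, Real.abs_exp]
    gcongr
    · exact hs.2
    · exact hM n _ (Real.toNNReal_le_iff_le_coe.2 hs.2)

/-- The exceptional points 0 and `a` are null for the integral, but `f t` survives in the boundary
term. -/
theorem expFunctional_of_ae_eq_const {t : ℝ≥0} {f : ℝ≥0 → ℝ} {c : ℝ} (a : ℝ≥0)
    (hf : ∀ x, x ≠ 0 → x ≠ a → f x = c) :
    expFunctional t f = Real.exp t * f t - c * (Real.exp t - 1) := by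
  rw [expFunctional, intervalIntegral.integral_congr_ae (g := fun s ↦ Real.exp s * c)]
  · rw [intervalIntegral.integral_mul_const, integral_exp, Real.exp_zero, mul_comm c]
  · filter_upwards [Measure.ae_ne volume (a : ℝ)] with s hs hs'
    rw [uIoc_of_le t.coe_nonneg] at hs'
    rw [hf]
    · exact (Real.toNNReal_pos.2 hs'.1).ne'
    · rintro rfl
      exact hs (Real.coe_toNNReal s hs'.1.le).symm

theorem measurable_expFunctional {K : ℝ≥0 → ℝ≥0 → ℝ}
    (hK : Continuous fun p : ℝ≥0 × ℝ≥0 ↦ K p.1 p.2) (s : ℝ≥0) :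
    Measurable fun a ↦ expFunctional s (K a) := by
  refine measurable_of_tendsto_metrizable (f := fun n a ↦ expSum n s (K a)) (fun n ↦ ?_)
    (tendsto_pi_nhds.2 fun a ↦ tendsto_expSum_of_continuous s
      (hK.comp (by fun_prop : Continuous fun b ↦ (a, b))))
  have : Continuous fun a ↦ expSum n s (K a) := by
    unfold expSum
    exact continuous_finsetSum _ fun j _ ↦
      (hK.comp (by fun_prop : Continuous fun a ↦ (a, expNode n s j))).const_mul _
  exact this.measurable

theorem abs_expFunctional_le {t : ℝ≥0} {f : ℝ≥0 → ℝ} {M : ℝ} (hc : Continuous f)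
    (hf : ∀ x ≤ t, |f x| ≤ M) : |expFunctional t f| ≤ (1 + t) * Real.exp t * M :=
  le_of_tendsto (tendsto_expSum_of_continuous t hc).abs
    (Eventually.of_forall fun n ↦ abs_expSum_le n t hf)

theorem continuous_fbmCov {H : ℝ} (hH : 0 < H) :
    Continuous fun p : ℝ≥0 × ℝ≥0 ↦ fbmCov H p.1 p.2 := by
  have h : 0 ≤ 2 * H := by positivity
  unfold fbmCov
  fun_prop (disch := intro _; exact Or.inr h)

theorem abs_fbmCov_le {H : ℝ} (hH : H ∈ Ioo (0 : ℝ) (1 / 2)) {T a b : ℝ≥0} (ha : a ≤ T)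
    (hb : b ≤ T) : |fbmCov H a b| ≤ 2 * (1 + T) := by
  -- Enlarging the base to 1 + T ≥ 1 allows the exponent 2H ≤ 1 to be raised to 1, so the bound does
  -- not depend on `H`.
  have key (x : ℝ) (h0 : 0 ≤ x) (hx : x ≤ T) : x ^ (2 * H) ≤ 1 + T :=
    calc x ^ (2 * H) ≤ (1 + T : ℝ) ^ (2 * H) :=
          Real.rpow_le_rpow h0 (by linarith) (by linarith [hH.1])
      _ ≤ (1 + T : ℝ) ^ (1 : ℝ) :=
          Real.rpow_le_rpow_of_exponent_le (by linarith [T.coe_nonneg]) (by linarith [hH.2])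
      _ = 1 + T := Real.rpow_one _
  have ha' : (a : ℝ) ≤ T := ha
  have hb' : (b : ℝ) ≤ T := hb
  have hab : |(a : ℝ) - b| ≤ T := abs_le.2 ⟨by linarith [a.coe_nonneg], by linarith [b.coe_nonneg]⟩
  have h1 := key a a.coe_nonneg ha'
  have h2 := key b b.coe_nonneg hb'
  have h3 := key _ (abs_nonneg _) hab
  have h4 := Real.rpow_nonneg a.coe_nonneg (2 * H)
  have h5 := Real.rpow_nonneg b.coe_nonneg (2 * H)
  have h6 := Real.rpow_nonneg (abs_nonneg ((a : ℝ) - b)) (2 * H)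
  rw [fbmCov, abs_le]
  constructor <;> linarith [T.coe_nonneg]

/-- The pointwise limit of the fractional covariance functions as `H ↓ 0`. -/
noncomputable def fbmCovZero (t s : ℝ≥0) : ℝ :=
  ((if t = 0 then 0 else 1) + (if s = 0 then 0 else 1) - (if t = s then 0 else 1)) / 2

theorem tendsto_rpow_two_mul (x : ℝ) :
    Tendsto (fun H : ℝ ↦ x ^ (2 * H)) (𝓝[>] 0) (𝓝 (if x = 0 then 0 else 1)) := by
  split_ifs with hx
  · refine tendsto_const_nhds.congr' ?_
    filter_upwards [self_mem_nhdsWithin] with H hH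
    rw [hx, Real.zero_rpow (by simpa using (mem_Ioi.1 hH).ne')]
  · have h : Tendsto (fun H : ℝ ↦ 2 * H) (𝓝 0) (𝓝 0) := by
      simpa using (continuous_const_mul (2 : ℝ)).tendsto 0
    have := ((Real.continuousAt_const_rpow hx (b := 0)).tendsto.comp h).mono_left
      (nhdsWithin_le_nhds (s := Ioi 0))
    simpa [Function.comp_def] using this

theorem tendsto_fbmCov (a b : ℝ≥0) :
    Tendsto (fun H ↦ fbmCov H a b) (𝓝[>] 0) (𝓝 (fbmCovZero a b)) := by
  have h := (((tendsto_rpow_two_mul a).add (tendsto_rpow_two_mul b)).sub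
    (tendsto_rpow_two_mul |(a : ℝ) - b|)).div_const 2
  simpa only [NNReal.coe_eq_zero, abs_eq_zero, sub_eq_zero, NNReal.coe_inj, fbmCov, fbmCovZero]
    using h

theorem expFunctional_expFunctional_fbmCovZero (t s : ℝ≥0) :
    (expFunctional t fun a ↦ expFunctional s (fbmCovZero a)) = R0 t s := by
  have h1 (a : ℝ≥0) : expFunctional s (fbmCovZero a) =
      Real.exp s * fbmCovZero a s - (if a = 0 then 0 else 1 / 2) * (Real.exp s - 1) := by
    refine expFunctional_of_ae_eq_const a fun x hx hxa ↦ ?_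
    rw [fbmCovZero, if_neg hx, if_neg (Ne.symm hxa)]
    split_ifs <;> norm_num
  simp only [h1]
  -- For s > 0 and a outside {0, s}, the inner value is e^s/2 - (e^s - 1)/2 = 1/2.
  rw [expFunctional_of_ae_eq_const (c := if s = 0 then 0 else 1 / 2) s]
  · rcases eq_or_ne t 0 with rfl | ht
    · rcases eq_or_ne s 0 with rfl | hs
      · simp [fbmCovZero, R0]
      · simp [fbmCovZero, R0, hs, hs.symm]
    rcases eq_or_ne s 0 with rfl | hs
    · simp [fbmCovZero, R0, ht]
    have hmin : min t s ≠ 0 := by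
      rcases min_choice t s with h | h <;> rw [h] <;> assumption
    rcases eq_or_ne t s with rfl | hts
    · have : Real.exp (2 * t) = Real.exp t * Real.exp t := by rw [two_mul, Real.exp_add]
      simp only [fbmCovZero, R0, ht, hmin, if_false, if_true, this]
      ring
    · simp only [fbmCovZero, R0, ht, hs, hts, hmin, if_false]
      ring
  · intro x hx hxs
    simp only [fbmCovZero, hx, hxs, if_false]
    rcases eq_or_ne s 0 with rfl | hs
    · simp
    · simp only [hs, if_false]
      ring

/-- The covariance of `expWiener B t` and `expWiener B s` for a process with covariance `fbmCov H`
converges to `R0 t s` as `H ↓ 0`. -/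
theorem tendsto_expFunctional_fbmCov {H : ℕ → ℝ} (hH : ∀ n, H n ∈ Ioo (0 : ℝ) (1 / 2))
    (hlim : Tendsto H atTop (𝓝[>] 0)) (t s : ℝ≥0) :
    Tendsto (fun n ↦ expFunctional t fun a ↦ expFunctional s (fbmCov (H n) a)) atTop
      (𝓝 (R0 t s)) := by
  have hcont (n : ℕ) (a : ℝ≥0) : Continuous (fbmCov (H n) a) :=
    (continuous_fbmCov (hH n).1).comp (by fun_prop : Continuous fun b ↦ (a, b))
  rw [← expFunctional_expFunctional_fbmCovZero]
  refine tendsto_expFunctional (M := (1 + s) * Real.exp s * (2 * (1 + max t s)))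
    (fun n ↦ measurable_expFunctional (continuous_fbmCov (hH n).1) s) (fun n a ha ↦ ?_) fun a ↦ ?_
  · refine abs_expFunctional_le (hcont n a) fun b hb ↦ ?_
    exact_mod_cast abs_fbmCov_le (hH n) (ha.trans (le_max_left t s)) (hb.trans (le_max_right t s))
  · exact tendsto_expFunctional (M := 2 * (1 + max a s)) (fun n ↦ (hcont n a).measurable)
      (fun n b hb ↦ by
        exact_mod_cast abs_fbmCov_le (hH n) (le_max_left a s) (hb.trans (le_max_right a s)))
      fun b ↦ (tendsto_fbmCov a b).comp hlim

/-! ### Characteristic functions of the transformed process -/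

namespace IsCenteredGaussian

variable {Ω : Type*} [MeasurableSpace Ω] {P : Measure Ω} {X : ℝ≥0 → Ω → ℝ} {K : ℝ≥0 → ℝ≥0 → ℝ}

theorem aemeasurable_expSum (hX : IsCenteredGaussian X P K) (n : ℕ) (t : ℝ≥0) :
    AEMeasurable (fun ω ↦ expSum n t (X · ω)) P :=
  Finset.aemeasurable_fun_sum _ fun _ _ ↦ (hX.isGaussianProcess.aemeasurable _).const_mul _

theorem ae_tendsto_expSum (hc : ∀ᵐ ω ∂P, Continuous fun t : ℝ≥0 ↦ X t ω) (t : ℝ≥0) :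
    ∀ᵐ ω ∂P, Tendsto (fun n ↦ expSum n t (X · ω)) atTop (𝓝 (expWiener X t ω)) := by
  filter_upwards [hc] with ω hω using tendsto_expSum_of_continuous t hω

theorem aemeasurable_expWiener (hX : IsCenteredGaussian X P K)
    (hc : ∀ᵐ ω ∂P, Continuous fun t : ℝ≥0 ↦ X t ω) (t : ℝ≥0) :
    AEMeasurable (expWiener X t) P :=
  aemeasurable_of_tendsto_metrizable_ae atTop (fun n ↦ hX.aemeasurable_expSum n t)
    (ae_tendsto_expSum hc t)

/-- Flattened over `ι × Option (Fin n)`, the double sum is a single linear combination of values of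
`X`. -/
theorem integral_cexp_sum_expSum (hX : IsCenteredGaussian X P K) {ι : Type*} [Fintype ι]
    (z : ι → ℝ) (t : ι → ℝ≥0) (n : ℕ) :
    ∫ ω, Complex.exp ((∑ i, z i * expSum n (t i) (X · ω) : ℝ) * Complex.I) ∂P =
      Complex.exp (-((∑ i, ∑ j, (expSum n (t i) fun a ↦ expSum n (t j) (K a)) * z i * z j : ℝ) : ℂ)
        / 2) := by
  have h := hX.integral_cexp_sum (fun p : ι × Option (Fin n) ↦ z p.1 * expWeight n (t p.1) p.2)
    (fun p ↦ expNode n (t p.1) p.2)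
  have h1 (ω : Ω) : ∑ i, z i * expSum n (t i) (X · ω) =
      ∑ p : ι × Option (Fin n), z p.1 * expWeight n (t p.1) p.2 * X (expNode n (t p.1) p.2) ω := by
    simp only [expSum, Fintype.sum_prod_type, Finset.mul_sum, mul_assoc]
  have h2 : ∑ i, ∑ j, (expSum n (t i) fun a ↦ expSum n (t j) (K a)) * z i * z j =
      ∑ p : ι × Option (Fin n), ∑ q : ι × Option (Fin n),
        K (expNode n (t p.1) p.2) (expNode n (t q.1) q.2) * (z p.1 * expWeight n (t p.1) p.2) *
          (z q.1 * expWeight n (t q.1) q.2) := by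
    simp only [expSum, Fintype.sum_prod_type, Finset.mul_sum, Finset.sum_mul]
    refine Finset.sum_congr rfl fun i _ ↦ ?_
    rw [Finset.sum_comm]
    refine Finset.sum_congr rfl fun _ _ ↦ Finset.sum_congr rfl fun _ _ ↦
      Finset.sum_congr rfl fun _ _ ↦ ?_
    ring
  simp only [h1, h2, h]

/-- The characteristic function of a linear combination of values of `expWiener X`. -/
theorem integral_cexp_sum_expWiener (hX : IsCenteredGaussian X P K)
    (hc : ∀ᵐ ω ∂P, Continuous fun t : ℝ≥0 ↦ X t ω)
    (hK : Continuous fun p : ℝ≥0 × ℝ≥0 ↦ K p.1 p.2) {ι : Type*} [Fintype ι]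
    (z : ι → ℝ) (t : ι → ℝ≥0) :
    ∫ ω, Complex.exp ((∑ i, z i * expWiener X (t i) ω : ℝ) * Complex.I) ∂P =
      Complex.exp (-((∑ i, ∑ j,
        (expFunctional (t i) fun a ↦ expFunctional (t j) (K a)) * z i * z j : ℝ) : ℂ) / 2) := by
  have := hX.isGaussianProcess.isProbabilityMeasure
  -- The same integrals have two limits: by dominated convergence along almost every path, and by
  -- the explicit Gaussian formula with double Riemann sums of `K`.
  refine tendsto_nhds_unique (f := fun n : ℕ ↦
    ∫ ω, Complex.exp ((∑ i, z i * expSum n (t i) (X · ω) : ℝ) * Complex.I) ∂P) (l := atTop) ?_ ?_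
  · refine tendsto_integral_of_dominated_convergence (fun _ ↦ 1) (fun n ↦ ?_)
      (integrable_const _) (fun n ↦ ae_of_all _ fun ω ↦ ?_) ?_
    · have (i : ι) := hX.aemeasurable_expSum n (t i)
      have : AEMeasurable (fun ω ↦
        Complex.exp ((∑ i, z i * expSum n (t i) (X · ω) : ℝ) * Complex.I)) P := by fun_prop
      exact this.aestronglyMeasurable
    · rw [Complex.norm_exp_ofReal_mul_I]
    · filter_upwards [ae_all_iff.2 fun i ↦ ae_tendsto_expSum hc (t i)] with ω hω
      have h : Tendsto (fun n ↦ ∑ i, z i * expSum n (t i) (X · ω)) atTop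
          (𝓝 (∑ i, z i * expWiener X (t i) ω)) :=
        tendsto_finsetSum _ fun i _ ↦ (hω i).const_mul _
      have hcont : Continuous fun x : ℝ ↦ Complex.exp (x * Complex.I) := by fun_prop
      exact (hcont.tendsto _).comp h
  · simp only [hX.integral_cexp_sum_expSum]
    have h : Tendsto (fun n ↦ ∑ i, ∑ j,
        (expSum n (t i) fun a ↦ expSum n (t j) (K a)) * z i * z j) atTop
        (𝓝 (∑ i, ∑ j, (expFunctional (t i) fun a ↦ expFunctional (t j) (K a)) * z i * z j)) :=
      tendsto_finsetSum _ fun i _ ↦ tendsto_finsetSum _ fun j _ ↦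
        ((tendsto_expSum_expSum _ _ hK).mul_const _).mul_const _
    have hcont : Continuous fun x : ℝ ↦ Complex.exp (-(x : ℂ) / 2) := by fun_prop
    exact (hcont.tendsto _).comp h

end IsCenteredGaussian

/-! ### Lévy's theorem and conclusion -/

theorem charFun_map_toLp {Ω ι : Type*} [MeasurableSpace Ω] [Fintype ι] {P : Measure Ω}
    {Y : Ω → ι → ℝ} (hY : AEMeasurable (fun ω ↦ WithLp.toLp 2 (Y ω)) P)
    (z : EuclideanSpace ℝ ι) :
    charFun (P.map fun ω ↦ WithLp.toLp 2 (Y ω)) z =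
      ∫ ω, Complex.exp ((∑ i, z i * Y ω i : ℝ) * Complex.I) ∂P := by
  rw [charFun_apply, integral_map hY (by fun_prop)]
  simp [PiLp.inner_apply]

/-- **Lévy's theorem** for random vectors in `Fin k → ℝ`, along a countably generated filter. -/
theorem tendstoInDistribution_of_tendsto_integral_cexp {α Ω' : Type*} {Ω : α → Type*}
    [∀ a, MeasurableSpace (Ω a)] {P : ∀ a, Measure (Ω a)} [∀ a, IsProbabilityMeasure (P a)]
    [MeasurableSpace Ω'] {P' : Measure Ω'} [IsProbabilityMeasure P'] {ι : Type*} [Fintype ι]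
    {X : ∀ a, Ω a → ι → ℝ} {Z : Ω' → ι → ℝ} {l : Filter α} [l.IsCountablyGenerated]
    (hX : ∀ a, AEMeasurable (X a) (P a)) (hZ : AEMeasurable Z P')
    (h : ∀ (u : ℕ → α), Tendsto u atTop l → ∀ z : ι → ℝ,
      Tendsto (fun n ↦ ∫ ω, Complex.exp ((∑ i, z i * X (u n) ω i : ℝ) * Complex.I) ∂P (u n)) atTop
        (𝓝 (∫ ω, Complex.exp ((∑ i, z i * Z ω i : ℝ) * Complex.I) ∂P'))) :
    TendstoInDistribution X l Z P P' := by
  -- `charFun` is taken with respect to an inner product, hence the detour through `EuclideanSpace`.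
  have hmeas : Measurable (WithLp.toLp 2 : (ι → ℝ) → EuclideanSpace ℝ ι) := by fun_prop
  have hX' (a : α) : AEMeasurable (fun ω ↦ WithLp.toLp 2 (X a ω)) (P a) :=
    hmeas.comp_aemeasurable (hX a)
  have hZ' : AEMeasurable (fun ω ↦ WithLp.toLp 2 (Z ω)) P' := hmeas.comp_aemeasurable hZ
  have key : TendstoInDistribution (fun a ω ↦ WithLp.toLp 2 (X a ω)) l
      (fun ω ↦ WithLp.toLp 2 (Z ω)) P P' := by
    refine ⟨hX', hZ', tendsto_of_seq_tendsto fun u hu ↦ ?_⟩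
    refine ProbabilityMeasure.tendsto_of_tendsto_charFun fun z ↦ ?_
    have := h u hu z
    rw [← charFun_map_toLp hZ'] at this
    exact this.congr fun n ↦ (charFun_map_toLp (hX' (u n)) z).symm
  exact key.continuous_comp (PiLp.continuous_ofLp 2 fun _ : ι ↦ ℝ)

theorem theorem2p5 :
    -- the limiting kernel is a covariance function
    IsCovarianceFunction R0 ∧
    -- there is a centered Gaussian process with this covariance function
    (∃ (Ω₀ : Type) (_ : MeasurableSpace Ω₀) (P₀ : Measure Ω₀) (X₀ : ℝ≥0 → Ω₀ → ℝ),
      IsProbabilityMeasure P₀ ∧ IsCenteredGaussian X₀ P₀ R0) ∧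
    -- convergence of all finite-dimensional distributions as `H ↓ 0`
    (∀ (Ω : Ioo (0 : ℝ) (1 / 2) → Type u) [∀ H, MeasurableSpace (Ω H)]
      (P : ∀ H, Measure (Ω H)) [∀ H, IsProbabilityMeasure (P H)]
      (B : ∀ H, ℝ≥0 → Ω H → ℝ) (_ : ∀ H : Ioo (0 : ℝ) (1 / 2), IsFBM (H : ℝ) (B H) (P H))
      (Ω₀ : Type v) [MeasurableSpace Ω₀] (P₀ : Measure Ω₀) [IsProbabilityMeasure P₀]
      (X₀ : ℝ≥0 → Ω₀ → ℝ) (_ : IsCenteredGaussian X₀ P₀ R0)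
      (k : ℕ) (t : Fin k → ℝ≥0),
      TendstoInDistribution (fun H ω i ↦ expWiener (B H) (t i) ω)
        (comap (fun H : Ioo (0 : ℝ) (1 / 2) ↦ (H : ℝ)) (𝓝[>] 0))
        (fun ω i ↦ X₀ (t i) ω) P P₀) := by
  obtain ⟨Ω₀, mΩ₀, P₀, X₀, hP₀, hX₀⟩ := exists_isCenteredGaussian_R0
  -- Positive definiteness comes from existence: the quadratic forms of `R0` are variances.
  refine ⟨hX₀.isCovarianceFunction, ⟨Ω₀, mΩ₀, P₀, X₀, hP₀, hX₀⟩, ?_⟩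
  intro Ω _ P _ B hB Ω' _ P' _ X hX k t
  refine tendstoInDistribution_of_tendsto_integral_cexp
    (fun H ↦ aemeasurable_pi_lambda _ fun i ↦
      (hB H).isCenteredGaussian.aemeasurable_expWiener (hB H).ae_continuous (t i))
    (aemeasurable_pi_lambda _ fun i ↦ hX.isGaussianProcess.aemeasurable (t i)) fun u hu z ↦ ?_
  simp only [fun n ↦ (hB (u n)).isCenteredGaussian.integral_cexp_sum_expWiener
    (hB (u n)).ae_continuous (continuous_fbmCov (u n).2.1) z t, hX.integral_cexp_sum z t]
  have h : Tendsto (fun n ↦ ∑ i, ∑ j, (expFunctional (t i) fun a ↦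
      expFunctional (t j) (fbmCov (u n) a)) * z i * z j) atTop
      (𝓝 (∑ i, ∑ j, R0 (t i) (t j) * z i * z j)) :=
    tendsto_finsetSum _ fun i _ ↦ tendsto_finsetSum _ fun j _ ↦
      ((tendsto_expFunctional_fbmCov (fun n ↦ (u n).2) (tendsto_comap_iff.1 hu) _ _).mul_const
        _).mul_const _
  have hcont : Continuous fun x : ℝ ↦ Complex.exp (-(x : ℂ) / 2) := by fun_prop
  exact (hcont.tendsto _).comp h
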